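/- Fix variables $x_1,x_2,\ldots$; a \emph{literal} is a variable $x$ or its formal inverse $x^{-1}$, with $\overline{x}=x^{-1}$ and $\overline{x^{-1}}=x$. A \emph{sequent} $\Gamma=\ell_1,\ldots,\ell_n$ ($n\ge 0$) is a finite sequence of literals; its inverse is $\overline{\Gamma}=\overline{\ell_n},\ldots,\overline{\ell_1}$, and $\Gamma,\Delta$ denotes concatenation. A \emph{hypersequent} $\mathcal G=\Gamma_1\mid\cdots\mid\Gamma_m$ is a finite set of sequents; $\mathcal G\mid\Gamma$ denotes $\mathcal G\cup\{\Gamma\}$. A sequent is identified with the group term $\ell_1\cdots\ell_n$ ($e$ if $n=0$), and it is \emph{group valid} if $\Gamma\approx e$ holds in all groups. An \emph{$\ell$-group} is a (not necessarily abelian) group with a lattice order such that $a\le b$ implies $cad\le cbd$. A non-empty hypersequent $\Gamma_1\mid\cdots\mid\Gamma_m$ is \emph{valid in all $\ell$-groups} if $e\le\Gamma_1\vee\cdots\vee\Gamma_m$ holds in every $\ell$-group under every assignment of the variables; the empty hypersequent is, by convention, not valid. For all hypersequents $\mathcal G$ and sequents $\Gamma,\Delta,\Sigma$, the calculus $\mathrm{GLG}$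 has the rules (gv) infer $\mathcal G\mid\Gamma$ from no premises, if $\Gamma$ is group valid; (em) infer $\mathcal G\mid\Delta\mid\overline{\Delta}$ from no premises; (cut) infer $\mathcal G\mid\Gamma,\Sigma$ from $\mathcal G\mid\Gamma,\Delta$ and $\mathcal G\mid\overline{\Delta},\Sigma$. The calculus $\mathrm{GLG}^*$ has the rules (gv); (split) infer $\mathcal G\mid\Gamma\mid\Delta$ from $\mathcal G\mid\Gamma,\Delta$; $(*)$ infer $\mathcal G$ from $\mathcal G\mid\Delta$ and $\mathcal G\mid\overline{\Delta}$, if $\Delta$ is not group valid. A hypersequent is \emph{derivable} in a calculus if it is the root of a finite tree of hypersequents each of whose nodes follows from its premises by a rule of the calculus. \textbf{Corollary.} For every hypersequent $\mathcal G$ the following are equivalent: (1) $\mathcal G$ is valid in all $\ell$-groups; (2) $\mathcal G$ is derivable in $\mathrm{GLG}$; (3) $\mathcal G$ is derivable in $\mathrm{GLG}^*$. -/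

import Mathlib

universe u v

namespace LGroupCalculi

/-- A literal over the variables `x₀, x₁, …`: the pair `(i, true)` stands for the variable `xᵢ`
and the pair `(i, false)` for its inverse `xᵢ⁻¹`. -/
abbrev Literal : Type := ℕ × Bool

/-- A sequent is a finite sequence of literals; the comma of sequents is `++`. -/
abbrev Sequent : Type := List Literal

/-- The inverse of a sequent: reverse the sequence and invert every literal. -/
def Sequent.inv (Γ : Sequent) : Sequent :=
  (Γ.map fun l => (l.1, !l.2)).reverse

/-- A hypersequent is a finite set of sequents; `G ∣ Γ` is `insert Γ G`. -/
abbrev Hypersequent : Type := Finset Sequent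

/-- The value of a sequent, read as the product of its literals (`1` if it has none), under an
assignment `v` of the variables in a group. -/
def Sequent.eval {H : Type u} [Group H] (v : ℕ → H) (Γ : Sequent) : H :=
  (Γ.map fun l => cond l.2 (v l.1) (v l.1)⁻¹).prod

/-- A sequent `Γ` is group valid if `Γ ≈ e` holds in all groups. -/
def Sequent.GroupValid (Γ : Sequent) : Prop :=
  ∀ (H : Type u) [Group H] (v : ℕ → H), Γ.eval v = 1

/-- A hypersequent `Γ₁ ∣ … ∣ Γₙ` is valid in all ℓ-groups if it is non-empty and
`e ≤ Γ₁ ∨ … ∨ Γₙ` holds in every lattice-ordered group (not necessarily commutative) under every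
assignment. The empty hypersequent is not valid: it stands for the empty join, which lies below
everything. -/
def Hypersequent.Valid (G : Hypersequent) : Prop :=
  ∃ hG : G.Nonempty,
    ∀ (L : Type u) [Group L] [Lattice L] [MulLeftMono L] [MulRightMono L] (v : ℕ → L),
      1 ≤ G.sup' hG (fun Γ => Γ.eval v)

/-- Derivability in the calculus GLG. -/
inductive GLG : Hypersequent → Prop
  | gv (G : Hypersequent) (Γ : Sequent) (hΓ : Sequent.GroupValid.{u} Γ) :
      GLG (insert Γ G)
  | em (G : Hypersequent) (Δ : Sequent) :
      GLG (insert Δ (insert Δ.inv G))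
  | cut (G : Hypersequent) (Γ Δ Θ : Sequent)
      (h₁ : GLG (insert (Γ ++ Δ) G)) (h₂ : GLG (insert (Δ.inv ++ Θ) G)) :
      GLG (insert (Γ ++ Θ) G)

/-- Derivability in the calculus GLG*. -/
inductive GLGStar : Hypersequent → Prop
  | gv (G : Hypersequent) (Γ : Sequent) (hΓ : Sequent.GroupValid.{u} Γ) :
      GLGStar (insert Γ G)
  | split (G : Hypersequent) (Γ Δ : Sequent) (h : GLGStar (insert (Γ ++ Δ) G)) :
      GLGStar (insert Γ (insert Δ G))
  | star (G : Hypersequent) (Δ : Sequent) (hΔ : ¬ Sequent.GroupValid.{u} Δ)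
      (h₁ : GLGStar (insert Δ G)) (h₂ : GLGStar (insert Δ.inv G)) :
      GLGStar G

end LGroupCalculi

/-!
A hypersequent is valid in all `ℓ`-groups, derivable in GLG, or derivable in GLG* exactly when in
every left order of the free group one of its components is nonnegative.

A left-ordered group acts by left translations on its own chain, and the automorphisms
of a chain form an `ℓ`-group; hence validity implies this condition. In an `ℓ`-group the negative
parts satisfy `(x * y)⁻ᵐ ≤ y⁻ᵐ * x⁻ᵐ`, and elements `p, q, r ≥ 1` satisfy
`p ⊓ q * r ≤ (p ⊓ q) * (p ⊓ r)`; this makes cut, and with it GLG, sound.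

If a hypersequent is not derivable in GLG, enlarge it to a maximal set of sequents with no
derivable finite subset. The group elements given by the sequents outside this set form the
positive cone of a total left-invariant preorder, in which every given component is negative. A
minimal total cone below it is pointed, because every nontrivial element `w` of a free group moves
`0` up in some action on `ℚ`, and such an action breaks ties. To find it, let the `k`-th letter of
the reduced word of `w`, counted from the right, move `k - 1` to `k`: reducedness makes the
requirements on each generator order preserving, so back and forth extends them to an automorphism
of `ℚ`. Pointedness is what makes the side condition of `(*)` sufficient for its soundness.
-/

open FreeGroup (mk)

namespace LGroupCalculi

section LatticeOrderedGroup

variable {L : Type*} [Group L] [Lattice L] [MulLeftMono L] [MulRightMono L]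

theorem leOnePart_inf_leOnePart_le_one_iff {x y : L} : x⁻ᵐ ⊓ y⁻ᵐ ≤ 1 ↔ 1 ≤ x ⊔ y := by
  constructor
  · intro h
    calc 1 ≤ (x⁻ᵐ ⊓ y⁻ᵐ)⁻¹ := one_le_inv'.2 h
      _ = x ⊓ 1 ⊔ y ⊓ 1 := by
        rw [leOnePart_eq_inv_inf_one, leOnePart_eq_inv_inf_one, inv_inf, inv_inv, inv_inv]
      _ ≤ x ⊔ y := sup_le_sup inf_le_left inf_le_left
  · intro h
    have le_mul_inv {a : L} (ha : a ≤ x ⊔ y) (hd : x⁻ᵐ ⊓ y⁻ᵐ ≤ a⁻ᵐ) :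
        a ≤ (x ⊔ y) * (x⁻ᵐ ⊓ y⁻ᵐ)⁻¹ :=
      calc a = a⁺ᵐ * (a⁻ᵐ)⁻¹ := by rw [← div_eq_mul_inv, oneLePart_div_leOnePart]
        _ ≤ (x ⊔ y) * (x⁻ᵐ ⊓ y⁻ᵐ)⁻¹ := mul_le_mul' (sup_le ha h) (inv_le_inv_iff.2 hd)
    have hsup : x ⊔ y ≤ (x ⊔ y) * (x⁻ᵐ ⊓ y⁻ᵐ)⁻¹ :=
      sup_le (le_mul_inv le_sup_left inf_le_left) (le_mul_inv le_sup_right inf_le_right)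
    exact one_le_inv'.1 ((le_mul_iff_one_le_right' _).1 hsup)

theorem leOnePart_mul_le (x y : L) : (x * y)⁻ᵐ ≤ y⁻ᵐ * x⁻ᵐ :=
  sup_le ((mul_inv_rev x y).trans_le (mul_le_mul' (inv_le_leOnePart y) (inv_le_leOnePart x)))
    (one_le_mul (one_le_leOnePart y) (one_le_leOnePart x))

theorem inf_mul_le_inf_mul_inf {p q r : L} (hp : 1 ≤ p) (hq : 1 ≤ q) (hr : 1 ≤ r) :
    p ⊓ q * r ≤ (p ⊓ q) * (p ⊓ r) := by
  simp only [inf_mul, mul_inf]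
  refine le_inf (le_inf ?_ ?_) (le_inf ?_ inf_le_right)
  · exact inf_le_left.trans (le_mul_of_one_le_left' hp)
  · exact inf_le_left.trans (le_mul_of_one_le_left' hq)
  · exact inf_le_left.trans (le_mul_of_one_le_right' hr)

theorem one_le_sup_mul {b x y : L} (hx : 1 ≤ b ⊔ x) (hy : 1 ≤ b ⊔ y) : 1 ≤ b ⊔ x * y := by
  rw [← leOnePart_inf_leOnePart_le_one_iff] at hx hy ⊢
  calc b⁻ᵐ ⊓ (x * y)⁻ᵐ ≤ b⁻ᵐ ⊓ y⁻ᵐ * x⁻ᵐ := inf_le_inf_left _ (leOnePart_mul_le x y)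
    _ ≤ (b⁻ᵐ ⊓ y⁻ᵐ) * (b⁻ᵐ ⊓ x⁻ᵐ) :=
      inf_mul_le_inf_mul_inf (one_le_leOnePart b) (one_le_leOnePart y) (one_le_leOnePart x)
    _ ≤ 1 := mul_le_one' hy hx

end LatticeOrderedGroup

section ChainAutomorphisms

variable {X : Type*} [LinearOrder X]

theorem surjective_sup_orderIso (f g : X ≃o X) : Function.Surjective fun x => f x ⊔ g x := by
  intro y
  rcases le_total (f.symm y) (g.symm y) with h | h
  · exact ⟨f.symm y, by simpa using g.le_symm_apply.1 h⟩
  · exact ⟨g.symm y, by simpa using f.le_symm_apply.1 h⟩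

theorem surjective_inf_orderIso (f g : X ≃o X) : Function.Surjective fun x => f x ⊓ g x :=
  surjective_sup_orderIso (X := Xᵒᵈ) f.dual g.dual

/-- The pointwise lattice order on the automorphisms of a chain. With composition as product it
makes them a lattice-ordered group. -/
noncomputable instance orderIsoLattice : Lattice (X ≃o X) where
  __ := PartialOrder.lift (fun f : X ≃o X => (f : X → X)) DFunLike.coe_injective
  sup f g := StrictMono.orderIsoOfSurjective (fun x => f x ⊔ g x)
    (fun _ _ h => max_lt_max (f.strictMono h) (g.strictMono h)) (surjective_sup_orderIso f g)
  inf f g := StrictMono.orderIsoOfSurjective (fun x => f x ⊓ g x)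
    (fun _ _ h => min_lt_min (f.strictMono h) (g.strictMono h)) (surjective_inf_orderIso f g)
  le_sup_left _ _ _ := le_sup_left
  le_sup_right _ _ _ := le_sup_right
  sup_le _ _ _ h₁ h₂ x := sup_le (h₁ x) (h₂ x)
  inf_le_left _ _ _ := inf_le_left
  inf_le_right _ _ _ := inf_le_right
  le_inf _ _ _ h₁ h₂ x := le_inf (h₁ x) (h₂ x)

instance orderIso_mulLeftMono : MulLeftMono (X ≃o X) :=
  ⟨fun f _ _ h x => f.monotone (h x)⟩

instance orderIso_mulRightMono : MulRightMono (X ≃o X) :=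
  ⟨fun f _ _ h x => h (f x)⟩

theorem sup'_orderIso_apply {ι : Type*} {s : Finset ι} (hs : s.Nonempty) (f : ι → X ≃o X) (x : X) :
    s.sup' hs f x = s.sup' hs fun i => f i x :=
  Finset.apply_sup'_eq_sup'_comp hs (fun g : X ≃o X => g x) fun _ _ => rfl

end ChainAutomorphisms

section LeftOrderedGroup

variable {K : Type*} [Group K]

/-- The left regular representation of a left-ordered group by automorphisms of its order. -/
def mulLeftHom (K : Type*) [Group K] [LinearOrder K] [MulLeftMono K] : K →* (K ≃o K) where
  toFun := OrderIso.mulLeft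
  map_one' := by ext x; exact one_mul x
  map_mul' a b := by ext x; exact mul_assoc a b x

/-- The linear order `a ≤ b ↔ a⁻¹ * b ∈ P` on a group with positive cone `P`. -/
noncomputable abbrev linearOrderOfCone (P : Submonoid K) (hp : P.IsMulPointed)
    (hs : P.IsMulSpanning) : LinearOrder K where
  le a b := a⁻¹ * b ∈ P
  le_refl a := by simp
  le_trans a b c hab hbc := by simpa [mul_assoc] using P.mul_mem hab hbc
  le_antisymm a b hab hba := inv_mul_eq_one.1 (hp _ hab (by simpa using hba))
  le_total a b := by simpa using hs (a⁻¹ * b)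
  toDecidableLE := Classical.decRel _

theorem mulLeftMono_linearOrderOfCone (P : Submonoid K) (hp : P.IsMulPointed)
    (hs : P.IsMulSpanning) :
    let _ := linearOrderOfCone P hp hs
    MulLeftMono K := by
  let _ := linearOrderOfCone P hp hs
  refine ⟨fun a b c (h : b⁻¹ * c ∈ P) => ?_⟩
  change (a * b)⁻¹ * (a * c) ∈ P
  simpa [mul_assoc] using h

end LeftOrderedGroup

section Cones

variable {F : Type*} [Group F]

theorem isMulSpanning_sInf_of_isChain {c : Set (Submonoid F)} (hc : ∀ P ∈ c, P.IsMulSpanning)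
    (hchain : IsChain (· ≤ ·) c) : (sInf c).IsMulSpanning := by
  intro a
  by_contra! h
  simp only [Submonoid.mem_sInf, not_forall] at h
  obtain ⟨⟨P, hP, haP⟩, Q, hQ, haQ⟩ := h
  rcases hchain.total hP hQ with hPQ | hQP
  · exact haQ (hPQ ((hc P hP a).resolve_left haP))
  · exact haP (hQP ((hc Q hQ a).resolve_right haQ))

/-- The lexicographic refinement of `P` by `R`: viewing both as cones of left-invariant preorders,
ties in the first preorder are broken by the second. -/
def lexCone (P R : Submonoid F) : Submonoid F where
  carrier := {a | a ∈ P ∧ (a⁻¹ ∈ P → a ∈ R)}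
  one_mem' := ⟨P.one_mem, fun _ => R.one_mem⟩
  mul_mem' := by
    rintro a b ⟨ha, ha'⟩ ⟨hb, hb'⟩
    refine ⟨P.mul_mem ha hb, fun hab => R.mul_mem (ha' ?_) (hb' ?_)⟩
    · simpa using P.mul_mem hb hab
    · simpa using P.mul_mem hab ha

theorem isMulSpanning_lexCone {P R : Submonoid F} (hP : P.IsMulSpanning) (hR : R.IsMulSpanning) :
    (lexCone P R).IsMulSpanning := by
  intro a
  have hPa := hP a
  have hRa := hR a
  change (a ∈ P ∧ (a⁻¹ ∈ P → a ∈ R)) ∨ (a⁻¹ ∈ P ∧ (a⁻¹⁻¹ ∈ P → a⁻¹ ∈ R))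
  rw [inv_inv]
  tauto

theorem exists_isMulPointed_isMulSpanning_le
    (hF : ∀ a : F, a ≠ 1 → ∃ R : Submonoid F, R.IsMulSpanning ∧ a ∉ R)
    {P : Submonoid F} (hP : P.IsMulSpanning) :
    ∃ Q ≤ P, Q.IsMulPointed ∧ Q.IsMulSpanning := by
  obtain ⟨Q, hQP, hQ⟩ : ∃ Q ≤ P, Minimal Submonoid.IsMulSpanning Q :=
    zorn_le_nonempty₀ (α := (Submonoid F)ᵒᵈ) {Q | (OrderDual.ofDual Q).IsMulSpanning}
      (fun c hc hchain _ _ => ⟨OrderDual.toDual (sInf c),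
        isMulSpanning_sInf_of_isChain hc hchain.symm,
        fun _ h => sInf_le (α := Submonoid F) h⟩) P hP
  refine ⟨Q, hQP, fun a ha hinv => ?_, hQ.prop⟩
  by_contra hne
  obtain ⟨R, hR, haR⟩ := hF a hne
  have hle : Q ≤ lexCone Q R := hQ.le_of_le (isMulSpanning_lexCone hQ.prop hR) fun _ h => h.1
  exact haR ((hle ha).2 hinv)

/-- The submonoid of the elements of an acting group which do not move the point `x` of a chain
down. -/
def actionCone {X : Type*} [LinearOrder X] (φ : F →* (X ≃o X)) (x : X) : Submonoid F where
  carrier := {a | x ≤ φ a x}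
  one_mem' := by simp
  mul_mem' {a b} (ha : x ≤ φ a x) (hb : x ≤ φ b x) :=
    calc x ≤ φ a x := ha
      _ ≤ φ a (φ b x) := (φ a).monotone hb
      _ = φ (a * b) x := by rw [map_mul, RelIso.mul_apply]

theorem isMulSpanning_actionCone {X : Type*} [LinearOrder X] (φ : F →* (X ≃o X)) (x : X) :
    (actionCone φ x).IsMulSpanning := by
  refine fun a => (le_total x (φ a x)).imp id fun h => ?_
  change x ≤ φ a⁻¹ x
  rw [map_inv]
  exact (φ a).le_symm_apply.2 h

end Cones

section BackAndForth

theorem exists_orderIso_extending_partialIso {α β : Type*} [LinearOrder α] [LinearOrder β]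
    [Countable α] [DenselyOrdered α] [NoMinOrder α] [NoMaxOrder α] [Nonempty α]
    [Countable β] [DenselyOrdered β] [NoMinOrder β] [NoMaxOrder β] [Nonempty β]
    (p : Order.PartialIso α β) : ∃ f : α ≃o β, ∀ x ∈ p.val, f x.1 = x.2 := by
  cases nonempty_encodable α
  cases nonempty_encodable β
  let total : α ⊕ β → Order.Cofinal (Order.PartialIso α β) :=
    Sum.elim (Order.PartialIso.definedAtLeft β) (Order.PartialIso.definedAtRight α)
  let I := Order.idealOfCofinals p total
  have cmp_eq : ∀ f ∈ I, ∀ g ∈ I, ∀ x ∈ f.val, ∀ y ∈ g.val, cmp x.1 y.1 = cmp x.2 y.2 := by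
    intro f hf g hg x hx y hy
    obtain ⟨h, -, hfh, hgh⟩ := I.directed f hf g hg
    exact h.prop x (hfh hx) y (hgh hy)
  have image : ∀ a, ∃ b, ∃ f ∈ I, (a, b) ∈ f.val := fun a => by
    obtain ⟨f, ⟨b, hb⟩, hf⟩ := Order.cofinal_meets_idealOfCofinals p total (.inl a)
    exact ⟨b, f, hf, hb⟩
  have preimage : ∀ b, ∃ a, ∃ f ∈ I, (a, b) ∈ f.val := fun b => by
    obtain ⟨f, ⟨a, ha⟩, hf⟩ := Order.cofinal_meets_idealOfCofinals p total (.inr b)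
    exact ⟨a, f, hf, ha⟩
  choose f F hF hf using image
  choose g H hH hg using preimage
  refine ⟨OrderIso.ofCmpEqCmp f g fun a b => cmp_eq _ (hF a) _ (hH b) _ (hf a) _ (hg b),
    fun x hx => ?_⟩
  have hx' := cmp_eq _ (hF x.1) _ (Order.mem_idealOfCofinals p total) _ (hf x.1) _ hx
  exact (cmp_eq_eq_iff _ _).1 (hx'.symm.trans (cmp_self_eq_eq _))

end BackAndForth

section FreeGroup

variable {α : Type*} {L : List (α × Bool)}

theorem length_ne_of_cons_suffix (hL : FreeGroup.IsReduced L) {i : α} {b : Bool}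
    {s t : List (α × Bool)} (hs : (i, b) :: s <:+ L) (ht : (i, !b) :: t <:+ L) :
    s.length ≠ t.length ∧ s.length ≠ t.length + 1 := by
  have eq_of_length_eq {u v : List (α × Bool)} (hu : u <:+ L) (hv : v <:+ L)
      (h : u.length = v.length) : u = v :=
    (List.suffix_of_suffix_length_le hu hv h.le).eq_of_length h
  constructor
  · intro h
    have := eq_of_length_eq hs ht (by simpa using h)
    simp at this
  · intro h
    have hst : s = (i, !b) :: t := eq_of_length_eq ((List.suffix_cons _ _).trans hs) ht h
    have := hL.infix (hst ▸ hs).isInfix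
    simp [FreeGroup.isReduced_cons_cons] at this

/-- The pair (point, required image) by which an automorphism assigned to a generator makes the
letter of sign `b` move `n` to `n + 1`. -/
def letterStep (b : Bool) (n : ℕ) : ℚ × ℚ :=
  cond b (n, n + 1) (n + 1, n)

theorem cmp_letterStep (hL : FreeGroup.IsReduced L) {i : α} {b c : Bool}
    {s t : List (α × Bool)} (hs : (i, b) :: s <:+ L) (ht : (i, c) :: t <:+ L) :
    cmp (letterStep b s.length).1 (letterStep c t.length).1 =
      cmp (letterStep b s.length).2 (letterStep c t.length).2 := by
  obtain rfl | rfl : c = b ∨ c = !b := by cases b <;> cases c <;> simp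
  · have cmp_succ (x y : ℚ) : cmp x y = cmp (x + 1) (y + 1) := (cmp_add_right x y 1).symm
    cases c
    · exact (cmp_succ _ _).symm
    · exact cmp_succ _ _
  · have hst := length_ne_of_cons_suffix hL hs ht
    have hts := length_ne_of_cons_suffix hL ht (by rwa [Bool.not_not])
    have hfar : s.length + 1 < t.length ∨ t.length + 1 < s.length := by omega
    rcases hfar with h | h
    · have h' : (s.length : ℚ) + 1 < t.length := mod_cast h
      cases b <;> simp only [letterStep, Bool.not_false, Bool.not_true, cond_true, cond_false] <;>
        rw [(cmp_eq_lt_iff _ _).2 (by linarith), (cmp_eq_lt_iff _ _).2 (by linarith)]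
    · have h' : (t.length : ℚ) + 1 < s.length := mod_cast h
      cases b <;> simp only [letterStep, Bool.not_false, Bool.not_true, cond_true, cond_false] <;>
        rw [(cmp_eq_gt_iff _ _).2 (by linarith), (cmp_eq_gt_iff _ _).2 (by linarith)]

theorem exists_orderIso_letterStep (hL : FreeGroup.IsReduced L) (i : α) :
    ∃ f : ℚ ≃o ℚ, ∀ (b : Bool) (s : List (α × Bool)), (i, b) :: s <:+ L →
      f (letterStep b s.length).1 = (letterStep b s.length).2 := by
  let S : Set (ℚ × ℚ) := {x | ∃ b s, (i, b) :: s <:+ L ∧ letterStep b s.length = x}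
  have hS : S.Finite := by
    refine (Set.finite_univ.image2 (fun b s => letterStep b s.length)
      L.tails.finite_toSet).subset ?_
    rintro _ ⟨b, s, hs, rfl⟩
    exact Set.mem_image2_of_mem (Set.mem_univ b)
      ((List.mem_tails _ _).2 ((List.suffix_cons _ s).trans hs))
  obtain ⟨f, hf⟩ := exists_orderIso_extending_partialIso (α := ℚ) (β := ℚ) ⟨hS.toFinset, by
    simp only [Set.Finite.mem_toFinset]
    rintro _ ⟨b, s, hs, rfl⟩ _ ⟨c, t, ht, rfl⟩
    exact cmp_letterStep hL hs ht⟩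
  exact ⟨f, fun b s hs => hf _ (hS.mem_toFinset.2 ⟨b, s, hs, rfl⟩)⟩

theorem exists_action_zero_lt {w : FreeGroup α} (hw : w ≠ 1) :
    ∃ φ : FreeGroup α →* (ℚ ≃o ℚ), 0 < φ w 0 := by
  classical
  have hL : FreeGroup.IsReduced w.toWord := FreeGroup.isReduced_toWord
  choose f hf using exists_orderIso_letterStep hL
  have lift_suffix : ∀ s, s <:+ w.toWord → FreeGroup.lift f (mk s) 0 = (s.length : ℚ) := by
    intro s
    induction s with
    | nil => simp [← FreeGroup.one_eq_mk]
    | cons l s ih =>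
      intro hs
      obtain ⟨i, b⟩ := l
      have hstep := hf i b s hs
      rw [← List.singleton_append, ← FreeGroup.mul_mk, map_mul, RelIso.mul_apply,
        ih ((List.suffix_cons _ s).trans hs), FreeGroup.lift_mk, List.map_singleton,
        List.prod_singleton, List.length_append, List.length_singleton, Nat.add_comm,
        Nat.cast_succ]
      cases b
      · exact (f i).symm_apply_eq.2 hstep.symm
      · exact hstep
  have hlen : 0 < w.toWord.length :=
    List.length_pos_of_ne_nil (FreeGroup.toWord_eq_nil_iff.not.2 hw)
  refine ⟨FreeGroup.lift f, ?_⟩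
  have := lift_suffix _ (List.suffix_refl _)
  rw [FreeGroup.mk_toWord] at this
  rw [this]
  exact_mod_cast hlen

theorem exists_isMulSpanning_notMem {w : FreeGroup α} (hw : w ≠ 1) :
    ∃ R : Submonoid (FreeGroup α), R.IsMulSpanning ∧ w ∉ R := by
  obtain ⟨φ, hφ⟩ := exists_action_zero_lt (inv_ne_one.2 hw)
  refine ⟨actionCone φ 0, isMulSpanning_actionCone φ 0, fun h : 0 ≤ φ w 0 => hφ.not_ge ?_⟩
  rw [map_inv]
  exact (φ w).symm_apply_le.2 h

end FreeGroup

section Sequents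

theorem Sequent.eval_eq_lift {H : Type*} [Group H] (v : ℕ → H) (Γ : Sequent) :
    Γ.eval v = FreeGroup.lift v (mk Γ) := rfl

theorem Sequent.eval_of (Γ : Sequent) : Γ.eval FreeGroup.of = mk Γ :=
  FreeGroup.lift_of_apply (mk Γ)

theorem Sequent.mk_inv (Γ : Sequent) : mk Γ.inv = (mk Γ)⁻¹ := rfl

theorem Sequent.mk_append (Γ Δ : Sequent) : mk (Γ ++ Δ) = mk Γ * mk Δ := rfl

theorem Sequent.eval_comp_monoidHom {H K : Type*} [Group H] [Group K] (f : H →* K) (v : ℕ → H)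
    (Γ : Sequent) : Γ.eval (f ∘ v) = f (Γ.eval v) := by
  rw [eval_eq_lift, eval_eq_lift, ← MonoidHom.comp_apply]
  exact (FreeGroup.lift_unique _ fun _ => congrArg f FreeGroup.lift_apply_of).symm

theorem Sequent.groupValid_iff (Γ : Sequent) : Sequent.GroupValid.{u} Γ ↔ mk Γ = 1 := by
  refine ⟨fun h => ?_, fun h H _ v => by rw [eval_eq_lift, h, map_one]⟩
  let φ : FreeGroup ℕ ≃* ULift.{u} (FreeGroup ℕ) := MulEquiv.ulift.symm
  have hφ : Γ.eval (φ ∘ FreeGroup.of) = φ (Γ.eval FreeGroup.of) :=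
    eval_comp_monoidHom φ.toMonoidHom FreeGroup.of Γ
  rw [h, eval_of] at hφ
  exact φ.map_eq_one_iff.1 hφ.symm

theorem GLG.monotone : Monotone GLG.{u} := by
  intro G G' hG h
  induction h generalizing G' with
  | gv G Γ hΓ =>
    rw [← Finset.insert_eq_of_mem (hG (Finset.mem_insert_self Γ G))]
    exact .gv G' Γ hΓ
  | em G Δ =>
    obtain ⟨hΔ, hΔ', -⟩ := by simpa only [Finset.insert_subset_iff] using hG
    rw [← Finset.insert_eq_of_mem hΔ, ← Finset.insert_eq_of_mem hΔ']
    exact .em G' Δ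
  | cut G Γ Δ Θ _ _ ih₁ ih₂ =>
    obtain ⟨hΓΘ, hG⟩ := Finset.insert_subset_iff.1 hG
    rw [← Finset.insert_eq_of_mem hΓΘ]
    exact .cut G' Γ Δ Θ (ih₁ (Finset.insert_subset_insert _ hG))
      (ih₂ (Finset.insert_subset_insert _ hG))

theorem GLGStar.monotone : Monotone GLGStar.{u} := by
  intro G G' hG h
  induction h generalizing G' with
  | gv G Γ hΓ =>
    rw [← Finset.insert_eq_of_mem (hG (Finset.mem_insert_self Γ G))]
    exact .gv G' Γ hΓ
  | split G Γ Δ _ ih =>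
    obtain ⟨hΓ, hΔ, hG⟩ := by simpa only [Finset.insert_subset_iff] using hG
    rw [← Finset.insert_eq_of_mem hΓ, ← Finset.insert_eq_of_mem hΔ]
    exact .split G' Γ Δ (ih (Finset.insert_subset_insert _ hG))
  | star G Δ hΔ _ _ ih₁ ih₂ =>
    exact .star G' Δ hΔ (ih₁ (Finset.insert_subset_insert _ hG))
      (ih₂ (Finset.insert_subset_insert _ hG))

end Sequents

section Simulation

variable {G : Hypersequent} {Γ Δ : Sequent}

theorem GLGStar.of_mk_mul_mk_eq_one (h : mk Γ * mk Δ = 1) :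
    GLGStar.{u} (insert Γ (insert Δ G)) :=
  .split G Γ Δ (.gv G _ ((Sequent.groupValid_iff _).2 h))

theorem GLGStar.star_of_mk_ne_one (h : mk Γ ≠ 1) (h₁ : GLGStar.{u} (insert Γ G))
    (h₂ : GLGStar.{u} (insert Γ.inv G)) : GLGStar.{u} G :=
  .star G Γ ((Sequent.groupValid_iff Γ).not.2 h) h₁ h₂

theorem GLGStar.congr (h : mk Γ = mk Δ) (hΓ : GLGStar.{u} (insert Γ G)) :
    GLGStar.{u} (insert Δ G) := by
  by_cases hΓ1 : mk Γ = 1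
  · exact .gv G Δ ((Sequent.groupValid_iff Δ).2 (h ▸ hΓ1))
  · refine .star_of_mk_ne_one hΓ1 (GLGStar.monotone (Finset.insert_subset_insert Γ ?_) hΓ) ?_
    · exact Finset.subset_insert Δ G
    · exact .of_mk_mul_mk_eq_one (by rw [Sequent.mk_inv, h, inv_mul_cancel])

theorem GLGStar.append (hΓ : GLGStar.{u} (insert Γ G)) (hΔ : GLGStar.{u} (insert Δ G)) :
    GLGStar.{u} (insert (Γ ++ Δ) G) := by
  by_cases hΓ1 : mk Γ = 1
  · exact hΔ.congr (by rw [Sequent.mk_append, hΓ1, one_mul])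
  by_cases hΔ1 : mk Δ = 1
  · exact hΓ.congr (by rw [Sequent.mk_append, hΔ1, mul_one])
  refine .star_of_mk_ne_one hΓ1 (GLGStar.monotone (Finset.insert_subset_insert Γ ?_) hΓ) ?_
  · exact Finset.subset_insert _ G
  refine .star_of_mk_ne_one hΔ1 (GLGStar.monotone (Finset.insert_subset_insert Δ ?_) hΔ) ?_
  · exact (Finset.subset_insert _ G).trans (Finset.subset_insert _ _)
  refine .split _ Δ.inv Γ.inv (.of_mk_mul_mk_eq_one ?_)
  rw [Sequent.mk_append, Sequent.mk_append, Sequent.mk_inv, Sequent.mk_inv]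
  group

theorem GLG.toGLGStar (h : GLG.{u} G) : GLGStar.{u} G := by
  induction h with
  | gv G Γ hΓ => exact .gv G Γ hΓ
  | em G Δ => exact .of_mk_mul_mk_eq_one (by rw [Sequent.mk_inv, mul_inv_cancel])
  | cut G Γ Δ Θ _ _ ih₁ ih₂ =>
    refine (ih₁.append ih₂).congr ?_
    simp only [Sequent.mk_append, Sequent.mk_inv]
    group

end Simulation

section Soundness

variable {G : Hypersequent}

/-- Validity in left orders: some component is nonnegative in every left order of the free group,
an order being given by its positive cone. -/
def Hypersequent.OrderValid (G : Hypersequent) : Prop :=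
  ∀ P : Submonoid (FreeGroup ℕ), P.IsMulPointed → P.IsMulSpanning → ∃ Γ ∈ G, mk Γ ∈ P

theorem GLGStar.orderValid (h : GLGStar.{u} G) : G.OrderValid := by
  intro P hp hs
  induction h with
  | gv G Γ hΓ =>
    exact ⟨Γ, Finset.mem_insert_self Γ G, (Sequent.groupValid_iff Γ).1 hΓ ▸ P.one_mem⟩
  | split G Γ Δ _ ih =>
    simp only [Finset.exists_mem_insert] at ih ⊢
    refine ih.elim (fun hΓΔ => ?_) fun hG => .inr (.inr hG)
    refine (hs (mk Δ)).elim (fun hΔ => .inr (.inl hΔ)) fun hΔ => .inl ?_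
    simpa only [Sequent.mk_append, mul_inv_cancel_right] using P.mul_mem hΓΔ hΔ
  | star G Δ hΔ _ _ ih₁ ih₂ =>
    rw [Finset.exists_mem_insert] at ih₁ ih₂
    refine ih₁.elim (fun h₁ => ih₂.elim (fun h₂ => ?_) id) id
    exact absurd ((Sequent.groupValid_iff Δ).2 (hp _ h₁ h₂)) hΔ

theorem GLG.one_le_of_forall_eval_le {L : Type*} [Group L] [Lattice L] [MulLeftMono L]
    [MulRightMono L] (h : GLG.{u} G) (v : ℕ → L) {b : L} (hb : ∀ Γ ∈ G, Γ.eval v ≤ b) :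
    1 ≤ b := by
  induction h generalizing b with
  | gv G Γ hΓ =>
    have hle := hb Γ (Finset.mem_insert_self Γ G)
    rwa [Sequent.eval_eq_lift, (Sequent.groupValid_iff Γ).1 hΓ, map_one] at hle
  | em G Δ =>
    rw [Finset.forall_mem_insert, Finset.forall_mem_insert, Sequent.eval_eq_lift v Δ.inv,
      Sequent.mk_inv, map_inv] at hb
    exact (one_le_mabs _).trans (sup_le hb.1 hb.2.1)
  | cut G Γ Δ Θ _ _ ih₁ ih₂ =>
    rw [Finset.forall_mem_insert] at hb
    have le_sup (Ξ : Sequent) : ∀ Λ ∈ insert Ξ G, Λ.eval v ≤ b ⊔ Ξ.eval v :=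
      (Finset.forall_mem_insert ..).2 ⟨le_sup_right, fun Λ hΛ => le_sup_of_le_left (hb.2 Λ hΛ)⟩
    have hmul : (Γ ++ Δ).eval v * (Δ.inv ++ Θ).eval v = (Γ ++ Θ).eval v := by
      simp only [Sequent.eval_eq_lift, Sequent.mk_append, Sequent.mk_inv, map_mul, map_inv]
      group
    have key := one_le_sup_mul (ih₁ (le_sup _)) (ih₂ (le_sup _))
    rwa [hmul, sup_eq_left.2 hb.1] at key

theorem GLG.valid (h : GLG.{u} G) : Hypersequent.Valid.{v} G := by
  have hne : G.Nonempty := by cases h <;> exact Finset.insert_nonempty _ _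
  exact ⟨hne, fun L _ _ _ _ v => h.one_le_of_forall_eval_le v fun Γ hΓ =>
    Finset.le_sup' (fun Γ : Sequent => Γ.eval v) hΓ⟩

end Soundness

section Completeness

variable {G : Hypersequent}

theorem Hypersequent.Valid.exists_one_le_eval (hG : Hypersequent.Valid.{v} G) {K : Type v}
    [Group K] [LinearOrder K] [MulLeftMono K] (w : ℕ → K) : ∃ Γ ∈ G, 1 ≤ Γ.eval w := by
  obtain ⟨hne, hval⟩ := hG
  have h : 1 ≤ (G.sup' hne fun Γ => Γ.eval (mulLeftHom K ∘ w)) 1 := hval _ (mulLeftHom K ∘ w) 1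
  rw [sup'_orderIso_apply, Finset.le_sup'_iff] at h
  obtain ⟨Γ, hΓ, h⟩ := h
  refine ⟨Γ, hΓ, ?_⟩
  rw [Sequent.eval_comp_monoidHom] at h
  exact h.trans_eq (mul_one _)

theorem Hypersequent.Valid.orderValid (hG : Hypersequent.Valid.{v} G) : G.OrderValid := by
  intro P hp hs
  let φ : ULift.{v} (FreeGroup ℕ) ≃* FreeGroup ℕ := MulEquiv.ulift
  let Q : Submonoid (ULift.{v} (FreeGroup ℕ)) := P.comap φ
  have hQp : Q.IsMulPointed := fun a ha ha' => φ.map_eq_one_iff.1 (hp _ ha ha')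
  have hQs : Q.IsMulSpanning := fun a => hs (φ a)
  let _ := linearOrderOfCone Q hQp hQs
  have := mulLeftMono_linearOrderOfCone Q hQp hQs
  obtain ⟨Γ, hΓ, h⟩ := hG.exists_one_le_eval (φ.symm ∘ FreeGroup.of)
  have hQ : (1 : ULift.{v} (FreeGroup ℕ))⁻¹ * Γ.eval (φ.symm ∘ FreeGroup.of) ∈ Q := h
  have heval : Γ.eval (φ.symm ∘ FreeGroup.of) = φ.symm (Γ.eval FreeGroup.of) :=
    Γ.eval_comp_monoidHom φ.symm.toMonoidHom FreeGroup.of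
  rw [heval, Sequent.eval_of, inv_one, one_mul, Submonoid.mem_comap] at hQ
  exact ⟨Γ, hΓ, by simpa using hQ⟩

theorem exists_maximal_underivable {α : Type*} [DecidableEq α] {D : Finset α → Prop}
    (hD : Monotone D) {G : Finset α} (hG : ¬ D G) :
    ∃ T : Set α, ↑G ⊆ T ∧ ∀ a, a ∉ T ↔ ∃ S : Finset α, ↑S ⊆ T ∧ D (insert a S) := by
  obtain ⟨T, hGT, hT⟩ := zorn_subset_nonempty {T : Set α | ∀ S : Finset α, ↑S ⊆ T → ¬ D S}
    (fun c hc hchain hne => ⟨⋃₀ c, fun S hS hDS => by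
      obtain ⟨t, ht, hSt⟩ := hchain.directedOn.exists_mem_subset_of_finite_of_subset_sUnion hne
        S.finite_toSet hS
      exact hc ht S hSt hDS, fun _ => Set.subset_sUnion_of_mem⟩) ↑G
    (fun S hS h => hG (hD (Finset.coe_subset.1 hS) h))
  refine ⟨T, hGT, fun a => ⟨fun ha => ?_, fun ⟨S, hS, hDS⟩ ha => ?_⟩⟩
  · by_contra! hno
    refine ha (hT.le_of_ge (y := insert a T) (fun S hS hDS => ?_) (Set.subset_insert a T)
      (Set.mem_insert a T))
    refine hno (S.erase a) ?_ (hD (Finset.insert_erase_subset a S) hDS)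
    rwa [Finset.coe_erase, Set.sdiff_singleton_subset_iff]
  · refine hT.prop (insert a S) ?_ hDS
    rw [Finset.coe_insert]
    exact Set.insert_subset ha hS

theorem GLG.append {Γ Δ : Sequent} (hΓ : GLG.{u} (insert Γ G)) (hΔ : GLG.{u} (insert Δ G)) :
    GLG.{u} (insert (Γ ++ Δ) G) :=
  .cut G Γ [] Δ (by rwa [List.append_nil]) hΔ

theorem GLG.congr {Γ Δ : Sequent} (h : mk Γ = mk Δ) (hΓ : GLG.{u} (insert Γ G)) :
    GLG.{u} (insert Δ G) :=
  .cut G [] Γ Δ hΓ <| .gv G _ <| (Sequent.groupValid_iff _).2 <| by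
    rw [Sequent.mk_append, Sequent.mk_inv, h, inv_mul_cancel]

theorem GLG.exists_isMulSpanning_of_not (hG : ¬ GLG.{u} G) :
    ∃ P : Submonoid (FreeGroup ℕ), P.IsMulSpanning ∧ ∀ Γ ∈ G, mk Γ ∉ P := by
  obtain ⟨T, hGT, hT⟩ := exists_maximal_underivable GLG.monotone hG
  have notMem_congr {Γ Δ : Sequent} (h : mk Γ = mk Δ) (hΓ : Γ ∉ T) : Δ ∉ T := by
    obtain ⟨S, hS, hΓS⟩ := (hT Γ).1 hΓ
    exact (hT Δ).2 ⟨S, hS, hΓS.congr h⟩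
  let P : Submonoid (FreeGroup ℕ) :=
    { carrier := {a | ∃ Γ ∉ T, mk Γ = a}
      one_mem' := ⟨[], (hT []).2 ⟨∅, by simp, .gv ∅ [] ((Sequent.groupValid_iff []).2 rfl)⟩, rfl⟩
      mul_mem' := by
        rintro _ _ ⟨Γ, hΓ, rfl⟩ ⟨Δ, hΔ, rfl⟩
        obtain ⟨S₁, hS₁, h₁⟩ := (hT Γ).1 hΓ
        obtain ⟨S₂, hS₂, h₂⟩ := (hT Δ).1 hΔ
        refine ⟨Γ ++ Δ, (hT _).2 ⟨S₁ ∪ S₂, by simp [hS₁, hS₂], .append ?_ ?_⟩, rfl⟩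
        · exact GLG.monotone (Finset.insert_subset_insert Γ Finset.subset_union_left) h₁
        · exact GLG.monotone (Finset.insert_subset_insert Δ Finset.subset_union_right) h₂ }
  refine ⟨P, fun a => ?_, fun Γ hΓ ⟨Δ, hΔ, h⟩ => notMem_congr h hΔ (hGT hΓ)⟩
  by_cases ha : Sequent.inv a.toWord ∈ T
  · refine .inl ⟨a.toWord, (hT _).2 ⟨{Sequent.inv a.toWord}, by simpa using ha, ?_⟩,
      FreeGroup.mk_toWord⟩
    exact GLG.em ∅ a.toWord
  · exact .inr ⟨_, ha, by rw [Sequent.mk_inv, FreeGroup.mk_toWord]⟩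

theorem GLG.of_orderValid (h : G.OrderValid) : GLG.{u} G := by
  by_contra hG
  obtain ⟨P, hP, hPG⟩ := GLG.exists_isMulSpanning_of_not hG
  obtain ⟨Q, hQP, hp, hs⟩ :=
    exists_isMulPointed_isMulSpanning_le (fun _ => exists_isMulSpanning_notMem) hP
  obtain ⟨Γ, hΓ, hΓQ⟩ := h Q hp hs
  exact hPG Γ hΓ (hQP hΓQ)

end Completeness

end LGroupCalculi

/-- Soundness and completeness of GLG and GLG* for ℓ-groups. The universe `v` of the ℓ-groups and
the universe `u` of the groups in the side conditions of the rules are arbitrary. -/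
theorem mainTheorem5 (G : LGroupCalculi.Hypersequent) :
    List.TFAE
      [LGroupCalculi.Hypersequent.Valid.{v} G,
        LGroupCalculi.GLG.{u} G,
        LGroupCalculi.GLGStar.{u} G] := by
  tfae_have 1 → 2 := fun h => .of_orderValid h.orderValid
  tfae_have 2 → 1 := fun h => h.valid
  tfae_have 2 → 3 := fun h => h.toGLGStar
  tfae_have 3 → 2 := fun h => .of_orderValid h.orderValid
  tfae_finish
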